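/- Let $M$ be a real symmetric matrix indexed by a finite set $X$ and let $K\subseteq X$. We say that $M$ exhibits pretty good fractional revival (PGFR) with respect to $K$ if the closure of the family $\{\exp(itM)_{K\times K} : t\ge 0\}$ of $K\times K$ submatrices contains a unitary $K\times K$ matrix that is not a scalar multiple of the identity. Let $D_K$ be the diagonal $X\times X$ matrix with diagonal entries $1$ at the indices in $K$ and $0$ elsewhere. For an integer $k\ge 0$ and a real algebraic number $m$ (in particular, any integer $m$), let $S_{k,m}$ be the weighted graph obtained from the path with $2k+1$ edges and consecutive vertices $p_1,\dots,p_{2k+2}$ by adding a loop of weight $m$ at $p_{k+1}$, one of the two vertices of the middle edge. For an integer $k\ge 1$, let $T_k$ be the graph obtained from the same path by adding two new vertices $x$ and $b$, where $x$ is adjacent to $p_k$ and $p_{k+1}$, and $b$ is adjacent to $p_{k+3}$. **Theorem.** Let $M$ be the adjacency matrix of either $S_{k,m}$ ($k\ge 0$, $m$ real algebraic) or $T_k$ ($k\ge 1$), and let $K=\{p_1,p_{2k+2}\}$ be the set of the two endpoints of the path. Let $Q$ be a transcendental real number. Then $M+Q\cdot D_K$ exhibits pretty good fractional revival with respect to $K$.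 -/

import Mathlib

namespace FractionalRevival

/-- The transition matrix `exp(i t M)` of the continuous-time quantum walk of a real matrix `M`. -/
noncomputable def walk {X : Type*} [Fintype X] [DecidableEq X]
    (M : Matrix X X ℝ) (t : ℝ) : Matrix X X ℂ :=
  NormedSpace.exp ((Complex.I * (t : ℂ)) • M.map (fun a : ℝ => (a : ℂ)))

/-- The `K × K` submatrix of an `X × X` matrix. -/
def block {X : Type*} (K : Finset X) (A : Matrix X X ℂ) : Matrix K K ℂ :=
  A.submatrix Subtype.val Subtype.val

/-- `M` exhibits pretty good fractional revival with respect to `K`: the closure of the family of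
`K × K` submatrices of `exp(i t M)`, `t ≥ 0`, contains a unitary matrix which is not a scalar
multiple of the identity. -/
def PrettyGoodFractionalRevival {X : Type*} [Fintype X] [DecidableEq X]
    (M : Matrix X X ℝ) (K : Finset X) : Prop :=
  ¬ (closure {A : Matrix K K ℂ | ∃ t : ℝ, 0 ≤ t ∧ A = block K (walk M t)} ∩
        {A : Matrix K K ℂ | A ∈ Matrix.unitaryGroup K ℂ}
      ⊆ {A : Matrix K K ℂ | ∃ ρ : ℂ, A = ρ • (1 : Matrix K K ℂ)})

/-- The diagonal matrix `D_K`, with diagonal entries `1` on `K` and `0` outside `K`. -/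
def diagInd {X : Type*} [DecidableEq X] (K : Finset X) : Matrix X X ℝ :=
  Matrix.diagonal (fun x => if x ∈ K then 1 else 0)

/-- The adjacency matrix of the weighted graph `S_{k,m}`: the path with `2k + 1` edges (vertices
`0, 1, …, 2k + 1`) with a loop of weight `m` at the vertex `k`, which is one of the two
vertices `k`, `k + 1` of the middle edge. -/
def matS (k : ℕ) (m : ℝ) : Matrix (Fin (2 * k + 2)) (Fin (2 * k + 2)) ℝ :=
  Matrix.of fun i j =>
    if i.val + 1 = j.val ∨ j.val + 1 = i.val then 1
    else if i.val = k ∧ j.val = k then m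
    else 0

/-- The two endpoints of the path in `S_{k,m}`. -/
def endsS (k : ℕ) : Finset (Fin (2 * k + 2)) := {0, Fin.last (2 * k + 1)}

/-- The two new vertices of `T_k`. -/
inductive Extra
  | x
  | b
  deriving DecidableEq

instance : Fintype Extra := ⟨{Extra.x, Extra.b}, by rintro (_ | _) <;> simp⟩

/-- Adjacency in `T_k`: the path with `2k + 1` edges (vertices `0, 1, …, 2k + 1`) and two new
vertices `x`, `b`. With the path vertices numbered from `0`, the vertex `x` is joined to the
path vertices `k - 1` and `k`, and `b` to `k + 2` (the `k`-th and `(k+1)`-st vertex, and the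
`(k+3)`-rd vertex, when counting from one). -/
def adjT (k : ℕ) : Fin (2 * k + 2) ⊕ Extra → Fin (2 * k + 2) ⊕ Extra → Prop
  | .inl i, .inl j => i.val + 1 = j.val ∨ j.val + 1 = i.val
  | .inl i, .inr .x => i.val + 1 = k ∨ i.val = k
  | .inr .x, .inl i => i.val + 1 = k ∨ i.val = k
  | .inl i, .inr .b => i.val = k + 2
  | .inr .b, .inl i => i.val = k + 2
  | .inr _, .inr _ => False

/-- The graph `T_k` (meaningful for `k ≥ 1`). -/
def graphT (k : ℕ) : SimpleGraph (Fin (2 * k + 2) ⊕ Extra) where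
  Adj := adjT k
  symm := ⟨by
    rintro (i | _ | _) (j | _ | _) h <;> simp only [adjT] at h ⊢ <;> first | exact h | exact h.symm⟩
  loopless := ⟨by
    rintro (i | _ | _) h <;> simp only [adjT] at h
    omega⟩

open scoped Classical in
/-- The adjacency matrix of `T_k`. -/
noncomputable def matT (k : ℕ) :
    Matrix (Fin (2 * k + 2) ⊕ Extra) (Fin (2 * k + 2) ⊕ Extra) ℝ :=
  (graphT k).adjMatrix ℝ

/-- The two endpoints of the path in `T_k`. -/
def endsT (k : ℕ) : Finset (Fin (2 * k + 2) ⊕ Extra) :=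
  {Sum.inl 0, Sum.inl (Fin.last (2 * k + 1))}

end FractionalRevival

/-!
Let `a`, `b` be the ends of the path, `N = M + Q D_K`, and let `h` be one of the two roots of
`h ^ 2 = m h + 1` (with `m = 2` for `T_k`); the product of the roots is `-1`. The two vectors
`h e_a + e_b` are orthogonal and span `ℝ^K`. Each generates an invariant subspace of `N` with an
explicit chain of basis vectors, on which `N` acts by a tridiagonal matrix; the two subspaces are
orthogonal and have the same dimension (`matS_chain`, `matT_chain`). An eigenvalue in the support of
`h e_a + e_b` is a root of a polynomial `A - Q B`, where `A` and `B` are consecutive terms of the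
three-term recurrence of the chain (`threeTerm`, `threeTerm_mul_eq`). They are monic and coprime and
have coefficients in the field `F` of real algebraic numbers.

As `Q` is transcendental, `A - Q B` is linear in an indeterminate over `F`, so by Gauss's lemma it is
irreducible over `F(Q)` (`pencil_irreducible_map`). Hence the normalized trace over `F(Q)` takes the
same value at all its roots, namely its negated second highest coefficient `Q - c` over the degree,
where `c ∈ F` is different for the two roots `h`. Applying the normalized trace to an integer
relation between the eigenvalues in the two supports, one finds that the coefficients of the
relation add up to zero on each support separately (`pencil_relations`).

By Kronecker's theorem, in a form which allows dependent frequencies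
(`exists_tendsto_exp_of_relations`), there are times `t ≥ 0` at which `exp (i t λ)` is close to `1`
for all `λ` in the first support and close to `-1` for all `λ` in the second. At these times
`exp (i t N)` nearly fixes one of the vectors `h e_a + e_b` and nearly negates the other, so its
`K × K` block is close to a reflection, which is unitary and not scalar (`prettyGood_of_sectors`).
-/

/-! ### Kronecker's approximation theorem -/

open Filter Topology
namespace FractionalRevival

/-- By orthogonality of distinct frequencies, the mean over `t ≥ 0` of the squared modulus of
`∑ j, exp (i (Λ j t - Θ j))` is the number of pairs of indices with equal frequencies; hence that
number is at most any bound on the squared modulus. -/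
theorem card_pairs_le_of_norm_le {J : Type*} [Fintype J] [DecidableEq J] (Λ Θ : J → ℝ)
    (hrel : ∀ i j, Λ i = Λ j → Θ i = Θ j) (C : ℝ)
    (hC : ∀ t : ℝ, 0 ≤ t → ‖∑ j, Complex.exp (Complex.I * (t * Λ j - Θ j))‖ ^ 2 ≤ C) :
    ((Finset.univ.filter fun q : J × J => Λ q.1 = Λ q.2).card : ℝ) ≤ C := by
  set e : J × J → ℝ → ℂ := fun q t =>
    Complex.exp (Complex.I * (t * Λ q.1 - Θ q.1)) *
      Complex.exp (-(Complex.I * (t * Λ q.2 - Θ q.2))) with he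
  have hsq : ∀ t : ℝ, ((‖∑ j, Complex.exp (Complex.I * (t * Λ j - Θ j))‖ ^ 2 : ℝ) : ℂ)
      = ∑ q : J × J, e q t := by
    intro t
    rw [← Complex.normSq_eq_norm_sq, Complex.normSq_eq_conj_mul_self, map_sum, mul_comm,
      Finset.sum_mul_sum, ← Finset.univ_product_univ, Finset.sum_product]
    refine Finset.sum_congr rfl fun i _ => Finset.sum_congr rfl fun j _ => ?_
    rw [he, ← Complex.exp_conj]
    simp
  have hexp : ∀ q t, e q t = Complex.exp (-(Complex.I * (Θ q.1 - Θ q.2))) *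
      Complex.exp ((Complex.I * (Λ q.1 - Λ q.2)) * t) := by
    intro q t
    simp only [he]
    rw [← Complex.exp_add, ← Complex.exp_add]
    ring_nf
  have hcont : ∀ q, Continuous (e q) := by
    intro q
    simp only [he]
    fun_prop
  -- The averages over `[0, T]` of the terms with nonzero frequency tend to `0`.
  have hmean : ∀ q : J × J, Tendsto (fun T : ℝ => (∫ t in (0 : ℝ)..T, e q t) / (T : ℂ)) atTop
      (𝓝 (if Λ q.1 = Λ q.2 then 1 else 0)) := by
    intro q
    split_ifs with h
    · have : ∀ t, e q t = 1 := by
        intro t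
        rw [hexp, h, hrel _ _ h]
        simp
      simp only [this]
      refine tendsto_const_nhds.congr' ?_
      filter_upwards [eventually_gt_atTop 0] with T hT
      have : (T : ℂ) ≠ 0 := by exact_mod_cast hT.ne'
      simp [this]
    · have hc : Complex.I * ((Λ q.1 : ℂ) - Λ q.2) ≠ 0 := by
        refine mul_ne_zero Complex.I_ne_zero (sub_ne_zero.2 ?_)
        exact_mod_cast h
      rw [tendsto_zero_iff_norm_tendsto_zero]
      refine squeeze_zero' (Eventually.of_forall fun _ => norm_nonneg _) ?_
        ((tendsto_const_nhds (x := 2 / ‖Complex.I * ((Λ q.1 : ℂ) - Λ q.2)‖)).div_atTop tendsto_id)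
      filter_upwards [eventually_gt_atTop 0] with T hT
      simp only [hexp]
      rw [intervalIntegral.integral_const_mul, integral_exp_mul_complex hc, norm_div, norm_mul,
        norm_div]
      have h1 : ‖Complex.exp (-(Complex.I * ((Θ q.1 : ℂ) - Θ q.2)))‖ = 1 := by
        rw [Complex.norm_exp]; simp
      have h2 : ‖Complex.exp (Complex.I * ((Λ q.1 : ℂ) - Λ q.2) * T) -
          Complex.exp (Complex.I * ((Λ q.1 : ℂ) - Λ q.2) * (0 : ℝ))‖ ≤ 2 := by
        refine (norm_sub_le _ _).trans ?_
        rw [Complex.norm_exp, Complex.norm_exp]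
        simp
        norm_num
      rw [h1, one_mul]
      have : ‖(T : ℂ)‖ = T := by simp [abs_of_pos hT]
      rw [this]
      simp only [id]
      gcongr
  have hlim : Tendsto (fun T : ℝ => (∫ t in (0 : ℝ)..T,
      ‖∑ j, Complex.exp (Complex.I * (t * Λ j - Θ j))‖ ^ 2) / T) atTop
      (𝓝 ((Finset.univ.filter fun q : J × J => Λ q.1 = Λ q.2).card : ℝ)) := by
    have := tendsto_finsetSum Finset.univ fun q _ => hmean q
    rw [Finset.sum_ite, Finset.sum_const, Finset.sum_const_zero, add_zero] at this
    have h2 := (Complex.continuous_re.tendsto _).comp this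
    have h3 : Complex.re ((Finset.univ.filter fun q : J × J => Λ q.1 = Λ q.2).card • (1 : ℂ))
      = ((Finset.univ.filter fun q : J × J => Λ q.1 = Λ q.2).card : ℝ) := by simp
    rw [h3] at h2
    refine h2.congr fun T => ?_
    simp only [Function.comp]
    rw [← Finset.sum_div, ← intervalIntegral.integral_finsetSum
      (fun q _ => (hcont q).intervalIntegrable _ _)]
    simp only [← hsq]
    rw [intervalIntegral.integral_ofReal, ← Complex.ofReal_div, Complex.ofReal_re]
  refine le_of_tendsto hlim ?_
  filter_upwards [eventually_gt_atTop 0] with T hT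
  rw [div_le_iff₀ hT]
  have h := intervalIntegral.integral_mono_on (a := 0) (b := T) (μ := MeasureTheory.volume)
    (f := fun t : ℝ => ‖∑ j, Complex.exp (Complex.I * (t * Λ j - Θ j))‖ ^ 2) (g := fun _ => C)
    hT.le (Continuous.intervalIntegrable (by fun_prop) _ _) (by simp) fun t ht => hC t ht.1
  simpa [mul_comm] using h

/-- The sum along a word `s` depends only on how often each letter occurs in it. -/
theorem sum_comp_eq_sum_count {ι R : Type*} [Fintype ι] [DecidableEq ι] [CommRing R] {p : ℕ}
    (s : Fin p → ι) (v : ι → R) :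
    ∑ a, v (s a) = ∑ i, ((Finset.univ.filter fun a => s a = i).card : R) * v i := by
  rw [← Finset.sum_fiberwise (s := Finset.univ) (g := s)]
  refine Finset.sum_congr rfl fun i _ => ?_
  rw [Finset.sum_congr rfl (g := fun _ => v i) (fun a ha => by rw [(Finset.mem_filter.1 ha).2])]
  simp

/-- The words of length `p` over an alphabet with weights `v`, grouped by total weight, fall into
at most `(p + 1) ^ |ι|` classes. -/
theorem card_image_words_le {ι : Type*} [Fintype ι] [DecidableEq ι] (v : ι → ℝ) (p : ℕ) :
    (Finset.univ.image fun s : Fin p → ι => ∑ a, v (s a)).card ≤ (p + 1) ^ Fintype.card ι := by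
  let cnt : (Fin p → ι) → ι → Fin (p + 1) := fun s i =>
    ⟨(Finset.univ.filter fun a => s a = i).card,
      Nat.lt_succ_of_le ((Finset.card_le_univ _).trans (by simp))⟩
  have : (Finset.univ.image fun s : Fin p → ι => ∑ a, v (s a)) ⊆
      (Finset.univ : Finset (ι → Fin (p + 1))).image fun c => ∑ i, ((c i : ℕ) : ℝ) * v i := by
    intro x hx
    obtain ⟨s, -, rfl⟩ := Finset.mem_image.1 hx
    exact Finset.mem_image.2 ⟨cnt s, Finset.mem_univ _, (sum_comp_eq_sum_count s v).symm⟩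
  refine (Finset.card_le_card this).trans (Finset.card_image_le.trans ?_)
  simp

/-- Cauchy–Schwarz for the fibres of a map `W`: many pairs of points have the same image. -/
theorem card_sq_le_card_image_mul_card_pairs {S R : Type*} [Fintype S] [DecidableEq R]
    (W : S → R) : (Fintype.card S : ℝ) ^ 2 ≤ ((Finset.univ.image W).card : ℝ) *
      ((Finset.univ.filter fun q : S × S => W q.1 = W q.2).card : ℝ) := by
  classical
  have h1 : Fintype.card S =
      ∑ x ∈ Finset.univ.image W, (Finset.univ.filter fun s => W s = x).card := by
    rw [← Finset.card_eq_sum_card_image W Finset.univ, Finset.card_univ]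
  have h2 : (Finset.univ.filter fun q : S × S => W q.1 = W q.2).card
      = ∑ x ∈ Finset.univ.image W, (Finset.univ.filter fun s => W s = x).card ^ 2 := by
    rw [Finset.card_eq_sum_card_fiberwise (f := fun q => W q.1) (t := Finset.univ.image W)]
    · refine Finset.sum_congr rfl fun x _ => ?_
      rw [sq, ← Finset.card_product]
      congr 1
      ext q
      simp only [Finset.mem_filter, Finset.mem_univ, true_and, Finset.mem_product]
      constructor
      · rintro ⟨h, rfl⟩; exact ⟨rfl, h.symm⟩
      · rintro ⟨rfl, h⟩; exact ⟨h.symm, rfl⟩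
    · intro q _
      exact Finset.mem_image_of_mem W (Finset.mem_univ q.1)
  rw [h1, h2]
  push_cast
  exact sq_sum_le_card_mul_sum_sq

/-- Many pairs of words of length `p` over an alphabet with weights `v` have equal weight. -/
theorem card_words_sq_le {ι : Type*} [Fintype ι] [DecidableEq ι] (v : ι → ℝ) (p : ℕ) :
    ((Fintype.card ι : ℝ) ^ p) ^ 2 ≤ ((p : ℝ) + 1) ^ Fintype.card ι *
      ((Finset.univ.filter fun q : (Fin p → ι) × (Fin p → ι) =>
        ∑ a, v (q.1 a) = ∑ a, v (q.2 a)).card : ℝ) := by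
  have h := card_sq_le_card_image_mul_card_pairs fun s : Fin p → ι => ∑ a, v (s a)
  rw [Fintype.card_fun, Fintype.card_fin, Nat.cast_pow] at h
  refine h.trans (mul_le_mul_of_nonneg_right ?_ (Nat.cast_nonneg _))
  exact_mod_cast card_image_words_le v p

/-- The supremum over `t ≥ 0` of a sum of unimodular exponentials is the number of its terms,
provided that its phases satisfy all integer relations of its frequencies. The `p`-th power of the
sum is a sum over words of length `p`, whose mean square is at least `N ^ (2 p) / (p + 1) ^ N` for
`N` terms; a bound on the sum below `N` would contradict this for large `p`. -/
theorem exists_norm_sum_exp_gt {ι : Type*} [Fintype ι] [DecidableEq ι] [Nonempty ι] (v θ : ι → ℝ)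
    (hrel : ∀ n : ι → ℤ, ∑ i, n i * v i = 0 → ∑ i, n i * θ i = 0) (δ : ℝ) (hδ : 0 < δ) :
    ∃ t : ℝ, 0 ≤ t ∧
      (Fintype.card ι : ℝ) - δ < ‖∑ i, Complex.exp (Complex.I * (t * v i - θ i))‖ := by
  classical
  by_contra! hcon
  set N := Fintype.card ι with hN
  have hNpos : (0 : ℝ) < N := by exact_mod_cast Fintype.card_pos
  have hC0 : 0 ≤ (N : ℝ) - δ := (norm_nonneg _).trans (hcon 0 le_rfl)
  have key : ∀ p : ℕ, 1 ≤ ((p : ℝ) + 1) ^ N * ((((N : ℝ) - δ) / N) ^ 2) ^ p := by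
    intro p
    have h := card_pairs_le_of_norm_le (J := Fin p → ι) (fun s => ∑ a, v (s a))
      (fun s => ∑ a, θ (s a)) ?_ ((((N : ℝ) - δ) ^ p) ^ 2) ?_
    · have h2 := (card_words_sq_le v p).trans (mul_le_mul_of_nonneg_left h (by positivity))
      rw [← pow_mul, mul_comm 2 p, pow_mul, div_pow, div_pow, ← mul_div_assoc,
        le_div_iff₀ (by positivity), one_mul]
      exact h2
    · intro s s' hss
      have h0 := hrel (fun i => ((Finset.univ.filter fun a => s a = i).card : ℤ) -
        ((Finset.univ.filter fun a => s' a = i).card : ℤ)) ?_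
      · simp only [Int.cast_sub, Int.cast_natCast, sub_mul, Finset.sum_sub_distrib] at h0
        rw [← sum_comp_eq_sum_count, ← sum_comp_eq_sum_count] at h0
        exact sub_eq_zero.1 h0
      · simp only [Int.cast_sub, Int.cast_natCast, sub_mul, Finset.sum_sub_distrib]
        rw [← sum_comp_eq_sum_count, ← sum_comp_eq_sum_count]
        exact sub_eq_zero.2 hss
    · intro t ht
      have : ∑ s : Fin p → ι, Complex.exp (Complex.I * (t * (∑ a, v (s a) : ℝ) -
          (∑ a, θ (s a) : ℝ))) = (∑ i, Complex.exp (Complex.I * (t * v i - θ i))) ^ p := by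
        rw [Fintype.sum_pow]
        refine Finset.sum_congr rfl fun s _ => ?_
        rw [← Complex.exp_sum]
        congr 1
        push_cast
        rw [← Finset.mul_sum, Finset.sum_sub_distrib, Finset.mul_sum]
      rw [this, norm_pow]
      gcongr
      exact hcon t ht
  -- A polynomial factor cannot compensate the exponential decay.
  have hr : |(((N : ℝ) - δ) / N) ^ 2| < 1 := by
    rw [abs_of_nonneg (by positivity)]
    have h1 : ((N : ℝ) - δ) / N < 1 := by rw [div_lt_one hNpos]; linarith
    have h0 : 0 ≤ ((N : ℝ) - δ) / N := by positivity
    nlinarith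
  set r := (((N : ℝ) - δ) / N) ^ 2 with hrdef
  have hr0 : 0 ≤ r := by positivity
  have hlim : Tendsto (fun p : ℕ => ((p : ℝ) + 1) ^ N * r ^ p) atTop (𝓝 0) := by
    have h := ((tendsto_pow_const_mul_const_pow_of_abs_lt_one N hr).const_mul (2 ^ N))
    rw [mul_zero] at h
    refine squeeze_zero' (Eventually.of_forall fun p => by positivity) ?_ h
    filter_upwards [eventually_ge_atTop 1] with p hp
    have hp' : (1 : ℝ) ≤ p := by exact_mod_cast hp
    calc ((p : ℝ) + 1) ^ N * r ^ p ≤ (2 * p) ^ N * r ^ p := by gcongr; linarith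
      _ = 2 ^ N * (p ^ N * r ^ p) := by rw [mul_pow]; ring
  exact absurd (ge_of_tendsto' hlim key) (by norm_num)

/-- **Kronecker's approximation theorem** with one-sided continuous time, for frequencies which may
be dependent: phases satisfying all integer relations of the frequencies are approximated
simultaneously. -/
theorem exists_tendsto_exp_of_relations {ι : Type*} [Fintype ι] (v θ : ι → ℝ)
    (hrel : ∀ n : ι → ℤ, ∑ i, n i * v i = 0 → ∑ i, n i * θ i = 0) :
    ∃ t : ℕ → ℝ, (∀ n, 0 ≤ t n) ∧ ∀ i, Tendsto
      (fun n => Complex.exp (Complex.I * t n * v i)) atTop (𝓝 (Complex.exp (Complex.I * θ i))) := by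
  classical
  -- An extra term with frequency and phase `0` pins down the common phase.
  have h := fun n : ℕ => exists_norm_sum_exp_gt (fun o : Option ι => o.elim 0 v)
    (fun o => o.elim 0 θ) (fun m hm => by
      simp only [Fintype.sum_option, Option.elim, mul_zero, zero_add] at hm ⊢
      exact hrel _ hm) (1 / ((n : ℝ) + 1)) (by positivity)
  choose t ht0 ht using h
  refine ⟨t, ht0, fun i => ?_⟩
  set z : ℕ → ℂ := fun n => Complex.exp (Complex.I * (t n * v i - θ i)) with hz
  have hz1 : ∀ n, ‖z n‖ = 1 := fun n => by
    rw [hz, Complex.norm_exp]; simp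
  have hbound : ∀ n, ‖z n - 1‖ ^ 2 ≤ 4 * (1 / ((n : ℝ) + 1)) := by
    intro n
    have h1 := ht n
    simp only [Fintype.sum_option, Option.elim, Fintype.card_option, Complex.ofReal_zero, mul_zero,
      sub_zero, Complex.exp_zero] at h1
    rw [← Finset.add_sum_erase _ _ (Finset.mem_univ i), ← add_assoc] at h1
    have h2 : ‖∑ j ∈ Finset.univ.erase i, Complex.exp (Complex.I * (t n * v j - θ j))‖
        ≤ (Fintype.card ι : ℝ) - 1 := by
      refine (norm_sum_le _ _).trans ?_
      rw [Finset.sum_congr rfl (g := fun _ => (1 : ℝ))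
        (fun j _ => by rw [Complex.norm_exp]; simp)]
      rw [Finset.sum_const, Finset.card_erase_of_mem (Finset.mem_univ i), Finset.card_univ,
        nsmul_eq_mul, mul_one, Nat.cast_pred (Fintype.card_pos_iff.2 ⟨i⟩)]
    have h3 := norm_add_le (1 + Complex.exp (Complex.I * (t n * v i - θ i)))
      (∑ j ∈ Finset.univ.erase i, Complex.exp (Complex.I * (t n * v j - θ j)))
    -- The sum is nearly maximal, so its terms `1` and `z n` nearly align.
    have h4 : 2 - 1 / ((n : ℝ) + 1) < ‖1 + z n‖ := by
      push_cast at h1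
      simp only [hz]
      linarith
    have h5 := parallelogram_law_with_norm ℝ (1 : ℂ) (z n)
    rw [hz1 n, norm_one, norm_sub_rev 1 (z n)] at h5
    have h6 : (0 : ℝ) < 1 / ((n : ℝ) + 1) := by positivity
    have h7 : 1 / ((n : ℝ) + 1) ≤ 1 := by
      rw [div_le_one (by positivity)]
      have : (0 : ℝ) ≤ n := by positivity
      linarith
    nlinarith
  have hzlim : Tendsto z atTop (𝓝 1) := by
    rw [tendsto_iff_norm_sub_tendsto_zero]
    have h := squeeze_zero (fun n => by positivity) hbound
      (by simpa using tendsto_one_div_add_atTop_nhds_zero_nat.const_mul (4 : ℝ))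
    have h' := (Real.continuous_sqrt.tendsto 0).comp h
    rw [Real.sqrt_zero] at h'
    refine h'.congr fun n => ?_
    simp [Real.sqrt_sq]
  have := hzlim.const_mul (Complex.exp (Complex.I * θ i))
  rw [mul_one] at this
  refine this.congr fun n => ?_
  rw [hz, ← Complex.exp_add]
  ring_nf

end FractionalRevival

/-! ### Roots of irreducible pencils -/

open Polynomial
namespace FractionalRevival

section ThreeTerm
variable {R : Type*} [CommRing R]

/-- The polynomials defined by the three-term recurrence `L (n + 2) = X * L (n + 1) - L n` with
initial values `L 0 = f` and `L 1 = g`. -/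
noncomputable def threeTerm (f g : R[X]) : ℕ → R[X]
  | 0 => f
  | 1 => g
  | n + 2 => X * threeTerm f g (n + 1) - threeTerm f g n

theorem isCoprime_threeTerm {f g : R[X]} (h : IsCoprime g f) :
    ∀ n, IsCoprime (threeTerm f g (n + 1)) (threeTerm f g n)
  | 0 => h
  | n + 1 => by
    have := (isCoprime_threeTerm h n).symm.neg_left.add_mul_left_left X
    convert! this using 1
    simp only [threeTerm]
    ring

/-- If `f` and `g` are monic of degrees `e` and `e + 1`, then `L n` is monic of degree `e + n`, and its
second highest coefficient is the same for all `n ≥ 1`. -/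
theorem threeTerm_natDegree_coeff [Nontrivial R] {f g : R[X]} {e : ℕ} {c : R}
    (hf : f.Monic) (hfe : f.natDegree = e) (hg : g.Monic) (hge : g.natDegree = e + 1)
    (hc : g.coeff e = c) :
    ∀ n, (threeTerm f g n).Monic ∧ (threeTerm f g n).natDegree = e + n ∧
      (threeTerm f g (n + 1)).coeff (e + n) = c
  | 0 => ⟨hf, hfe, hc⟩
  | 1 => by
    refine ⟨hg, hge, ?_⟩
    simp only [threeTerm, coeff_sub, coeff_X_mul, hc]
    rw [coeff_eq_zero_of_natDegree_lt (by omega), sub_zero]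
  | n + 2 => by
    obtain ⟨m0, d0, -⟩ := threeTerm_natDegree_coeff hf hfe hg hge hc n
    obtain ⟨m1, d1, c1⟩ := threeTerm_natDegree_coeff hf hfe hg hge hc (n + 1)
    have hd : (X * threeTerm f g (n + 1)).natDegree = e + (n + 2) := by
      rw [natDegree_X_mul m1.ne_zero, d1]; ring
    have hlt : (threeTerm f g n).natDegree < (X * threeTerm f g (n + 1)).natDegree := by omega
    have hm : (X * threeTerm f g (n + 1)).Monic := monic_X.mul m1
    have h2 : threeTerm f g (n + 2) = X * threeTerm f g (n + 1) - threeTerm f g n := rfl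
    refine ⟨?_, ?_, ?_⟩
    · rw [h2]; exact hm.sub_of_left (degree_lt_degree hlt)
    · rw [h2, natDegree_sub_eq_left_of_natDegree_lt hlt, hd]
    · have h3 : threeTerm f g (n + 2 + 1) =
        X * threeTerm f g (n + 2) - threeTerm f g (n + 1) := rfl
      rw [h3, coeff_sub, ← add_assoc e n 2, show e + n + 2 = (e + (n + 1)) + 1 by ring, coeff_X_mul,
        c1, coeff_eq_zero_of_natDegree_lt (by omega), sub_zero]

end ThreeTerm

section Pencil
variable {F : Type*} [Field F]

/-- The pencil `A - Y B`, as a polynomial in `X` with coefficients in `F[Y]`. The inner variable is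
the indeterminate `Y`, which is later specialized to `Q`. -/
noncomputable def pencil (A B : F[X]) : F[X][X] := A.map C - C X * B.map C

/-- For coprime `A` and `B`, the pencil is primitive of degree one in `Y`. -/
theorem pencil_irreducible {A B : F[X]} (hB : B ≠ 0) (h : IsCoprime A B) :
    Irreducible (pencil A B) := by
  have hs : pencil A B = Bivariate.swap (C A - X * C B) := by
    rw [map_sub, map_mul, Bivariate.swap_C, Bivariate.swap_C, Bivariate.swap_Y]
    rfl
  rw [hs, MulEquiv.irreducible_iff]
  convert! irreducible_C_mul_X_add_C (neg_ne_zero.mpr hB)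
      ((IsCoprime.neg_right_iff _ _).mpr h).symm.isRelPrime using 1
  rw [add_comm, X_mul_C, map_neg, neg_mul, sub_eq_add_neg]

theorem pencil_monic {A B : F[X]} (hA : A.Monic) (hd : B.natDegree < A.natDegree) :
    (pencil A B).Monic ∧ (pencil A B).natDegree = A.natDegree := by
  have h1 : (C X * B.map (C : F →+* F[X])).natDegree < (A.map (C : F →+* F[X])).natDegree := by
    rw [natDegree_map_eq_of_injective C_injective]
    refine (natDegree_C_mul_le _ _).trans_lt ?_
    rwa [natDegree_map_eq_of_injective C_injective]
  refine ⟨(hA.map C).sub_of_left (degree_lt_degree h1), ?_⟩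
  rw [pencil, natDegree_sub_eq_left_of_natDegree_lt h1, natDegree_map_eq_of_injective C_injective]

/-- By Gauss's lemma the pencil is irreducible over the fraction field of `F[Y]`. -/
theorem pencil_irreducible_map {A B : F[X]} (hA : A.Monic) (hd : B.natDegree < A.natDegree)
    (hB : B ≠ 0) (h : IsCoprime A B) (K : Type*) [Field K] [Algebra F[X] K]
    [IsFractionRing F[X] K] : Irreducible ((pencil A B).map (algebraMap F[X] K)) :=
  ((pencil_monic hA hd).1.irreducible_iff_irreducible_map_fraction_map).1
    (pencil_irreducible hB h)

end Pencil

/-- The normalized trace of an element is determined by any monic irreducible polynomial which it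
is a root of. -/
theorem normalizedTrace_of_irreducible {K L : Type*} [Field K] [Field L] [Algebra K L]
    [CharZero K] [Algebra.IsAlgebraic K L] {p : K[X]} (hp : Irreducible p) (hm : p.Monic) {x : L}
    (hx : aeval x p = 0) :
    Algebra.normalizedTrace K L x = ((p.natDegree : K))⁻¹ * -p.nextCoeff := by
  have : Algebra.IsIntegral K L := Algebra.IsAlgebraic.isIntegral
  rw [Algebra.normalizedTrace_minpoly, ← minpoly.eq_of_irreducible_of_monic hp hx hm, smul_eq_mul]

/-- An integer relation between roots of monic irreducible polynomials of the same
degree is inherited by the next coefficients of these polynomials. -/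
theorem sum_nextCoeff_eq_zero {K E : Type*} [Field K] [Field E] [Algebra K E] [CharZero K]
    {S : Type*} (p : S → K[X]) (d : ℕ) (hirr : ∀ s, Irreducible (p s)) (hm : ∀ s, (p s).Monic)
    (hd : ∀ s, (p s).natDegree = d) (hd0 : d ≠ 0)
    {ι : Type*} [Fintype ι] (x : ι → E) (s : ι → S) (hx : ∀ i, aeval (x i) (p (s i)) = 0)
    (n : ι → ℤ) (hn : ∑ i, n i * x i = 0) : ∑ i, (n i : K) * (p (s i)).nextCoeff = 0 := by
  have halg : ∀ i, x i ∈ algebraicClosure K E := fun i =>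
    mem_algebraicClosure_iff.2 ⟨p (s i), (hm _).ne_zero, hx i⟩
  have hn' : ∑ i, (n i) • (⟨x i, halg i⟩ : algebraicClosure K E) = 0 := by
    apply Subtype.ext
    push_cast
    simpa [zsmul_eq_mul] using hn
  have h := congrArg (Algebra.normalizedTrace K (algebraicClosure K E)) hn'
  rw [map_sum, map_zero] at h
  have hterm : ∀ i, Algebra.normalizedTrace K (algebraicClosure K E)
      ((n i) • (⟨x i, halg i⟩ : algebraicClosure K E))
      = -(d : K)⁻¹ * ((n i : K) * (p (s i)).nextCoeff) := by
    intro i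
    rw [map_zsmul, normalizedTrace_of_irreducible (hirr (s i)) (hm (s i)), hd, zsmul_eq_mul]
    · ring
    · have := hx i
      apply Subtype.ext
      exact (aeval_algHom_apply (algebraicClosure K E).val _ _).symm.trans this
  simp only [hterm] at h
  rw [← Finset.mul_sum] at h
  refine (mul_eq_zero.1 h).resolve_left (neg_ne_zero.2 (inv_ne_zero ?_))
  exact_mod_cast hd0

/-- Let `Q` be transcendental over `F`, and let `A s - Q B s` be polynomials, with `A s` and `B s`
coprime over `F` and monic of degrees `d + 1` and `d`. The second highest coefficient of
`A s - Q B s` is `c s - Q`, where `c s` is that of `A s`. So an integer relation between roots of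
these polynomials gives one between the numbers `c s - Q`, which splits in two as `Q` is
transcendental. -/
theorem pencil_relations {F : Type*} [Field F] [CharZero F] [Algebra F ℝ] {Q : ℝ}
    (hQ : Transcendental F Q) {S : Type*} (A B : S → F[X]) (d : ℕ) (c : S → F)
    (hA : ∀ s, (A s).Monic) (hAd : ∀ s, (A s).natDegree = d + 1)
    (hB : ∀ s, (B s).Monic) (hBd : ∀ s, (B s).natDegree = d)
    (hcop : ∀ s, IsCoprime (A s) (B s)) (hc : ∀ s, (A s).coeff d = c s)
    {ι : Type*} [Fintype ι] (x : ι → ℝ) (s : ι → S)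
    (hx : ∀ i, aeval (x i) (A (s i)) - Q * aeval (x i) (B (s i)) = 0)
    (n : ι → ℤ) (hn : ∑ i, n i * x i = 0) :
    ∑ i, n i = 0 ∧ ∑ i, (n i : F) * c (s i) = 0 := by
  let _ : Algebra F[X] ℝ := (aeval Q : F[X] →ₐ[F] ℝ).toRingHom.toAlgebra
  have hinj : Function.Injective (algebraMap F[X] ℝ) := transcendental_iff_injective.1 hQ
  have : FaithfulSMul F[X] ℝ := (faithfulSMul_iff_algebraMap_injective _ _).2 hinj
  let : Algebra (FractionRing F[X]) ℝ := FractionRing.liftAlgebra F[X] ℝ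
  have hlt : ∀ s, (B s).natDegree < (A s).natDegree := fun s => by rw [hAd, hBd]; omega
  have hX : ∀ (P : F[X]) (y : ℝ), (P.map (C : F →+* F[X])).eval₂ (algebraMap F[X] ℝ) y
      = aeval y P := by
    intro P y
    rw [eval₂_map, aeval_def]
    congr 1
    ext a
    exact aeval_C Q a
  have hnext : ∀ s, (pencil (A s) (B s)).nextCoeff = C (c s) - X := by
    intro s
    rw [nextCoeff_of_natDegree_pos (by rw [(pencil_monic (hA s) (hlt s)).2, hAd]; omega),
      (pencil_monic (hA s) (hlt s)).2, hAd, Nat.add_sub_cancel, pencil, coeff_sub, coeff_C_mul,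
      coeff_map, coeff_map, hc]
    have : (B s).coeff d = 1 := by
      have := (hB s).coeff_natDegree
      rwa [hBd] at this
    rw [this, map_one, mul_one]
  have hKinj := IsFractionRing.injective F[X] (FractionRing F[X])
  have h := sum_nextCoeff_eq_zero (K := FractionRing F[X]) (E := ℝ)
    (fun s => (pencil (A s) (B s)).map (algebraMap F[X] (FractionRing F[X]))) (d + 1)
    (fun s => pencil_irreducible_map (hA s) (hlt s) (hB s).ne_zero (hcop s) _)
    (fun s => (pencil_monic (hA s) (hlt s)).1.map _)
    (fun s => by rw [natDegree_map_eq_of_injective hKinj, (pencil_monic (hA s) (hlt s)).2, hAd])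
    (Nat.succ_ne_zero d) x s (fun i => by
      rw [aeval_map_algebraMap, aeval_def, pencil, eval₂_sub, eval₂_mul, eval₂_C, hX, hX]
      have : algebraMap F[X] ℝ X = Q := aeval_X Q
      rw [this, hx]) n hn
  have h2 : ∑ i, (n i : F[X]) * (C (c (s i)) - X) = 0 := by
    apply hKinj
    rw [map_sum, map_zero, ← h]
    refine Finset.sum_congr rfl fun i _ => ?_
    rw [nextCoeff_map hKinj, hnext, map_mul, map_intCast]
  have e1 := congrArg (fun P : F[X] => P.coeff 1) h2
  have e0 := congrArg (fun P : F[X] => P.coeff 0) h2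
  simp only [finsetSum_coeff, coeff_zero, ← C_eq_intCast, coeff_C_mul, coeff_sub, coeff_X_zero,
    coeff_X_one, sub_zero, coeff_C_zero, coeff_C_succ, zero_sub, mul_neg, mul_one] at e1 e0
  refine ⟨?_, e0⟩
  rw [Finset.sum_neg_distrib, neg_eq_zero] at e1
  exact_mod_cast e1

end FractionalRevival

/-! ### Reduction to the spectrum -/

open Matrix Filter Topology
namespace FractionalRevival

/-- The spectral expansion of the entries of `exp (i t M)` for a real symmetric matrix `M`. -/
theorem walk_apply {X : Type*} [Fintype X] [DecidableEq X] {M : Matrix X X ℝ}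
    (hM : M.IsHermitian) (t : ℝ) (x y : X) :
    walk M t x y = ∑ z, (hM.eigenvectorBasis z x : ℂ) *
      Complex.exp (Complex.I * t * hM.eigenvalues z) * (hM.eigenvectorBasis z y : ℂ) := by
  set U : Matrix X X ℝ := ↑hM.eigenvectorUnitary with hU
  have hUU : U * star U = 1 := Unitary.coe_mul_star_self hM.eigenvectorUnitary
  set Uc : Matrix X X ℂ := U.map (algebraMap ℝ ℂ) with hUc
  set Vc : Matrix X X ℂ := (star U).map (algebraMap ℝ ℂ) with hVc
  have hUV : Uc * Vc = 1 := by
    rw [hUc, hVc, ← Matrix.map_mul, hUU, Matrix.map_one _ (map_zero _) (map_one _)]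
  have hinv : Uc⁻¹ = Vc := Matrix.inv_eq_right_inv hUV
  have hunit : IsUnit Uc := IsUnit.of_mul_eq_one _ hUV
  have hspec : M = U * diagonal hM.eigenvalues * star U := by
    have := hM.spectral_theorem
    rw [Unitary.conjStarAlgAut_apply] at this
    exact this
  have hmap : M.map (fun a : ℝ => (a : ℂ)) =
      Uc * diagonal (fun z => (hM.eigenvalues z : ℂ)) * Uc⁻¹ := by
    have h1 : M.map (algebraMap ℝ ℂ) = _ := congrArg (fun A => A.map (algebraMap ℝ ℂ)) hspec
    rw [Matrix.map_mul, Matrix.map_mul, Matrix.diagonal_map (map_zero _)] at h1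
    rw [hinv]
    exact h1
  rw [walk, hmap, ← smul_mul_assoc, ← mul_smul_comm, Matrix.exp_conj _ _ hunit,
    ← Matrix.diagonal_smul, Matrix.exp_diagonal, hinv, Matrix.mul_apply]
  refine Finset.sum_congr rfl fun z _ => ?_
  rw [Matrix.mul_diagonal, Pi.coe_exp, ← Complex.exp_eq_exp_ℂ]
  rfl

/-- Completeness of the eigenvector basis, in coordinates. -/
theorem sum_eigenvectorBasis_mul {X : Type*} [Fintype X] [DecidableEq X] {M : Matrix X X ℝ}
    (hM : M.IsHermitian) (x y : X) :
    ∑ z, hM.eigenvectorBasis z x * hM.eigenvectorBasis z y = if x = y then 1 else 0 := by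
  have h := congrFun (congrFun (Unitary.coe_mul_star_self hM.eigenvectorUnitary) x) y
  rw [Matrix.mul_apply, Matrix.one_apply] at h
  rw [← h]
  rfl

/-- Suppose that `h false * h true = -1`, so that the vectors `h s • e_a + e_b` are orthogonal. If
every integer relation between eigenvalues in the supports of the two vectors has coefficients that
add up to zero on the second support, then `exp (i t M)` can approximately fix the first vector and
negate the second one, and thus its `{a, b}` block comes close to a reflection. Here `R s μ` is a
necessary condition for the eigenvalue `μ` to lie in the support of the vector `s`. -/
theorem prettyGood_of_sectors {X : Type} [Fintype X] [DecidableEq X] {M : Matrix X X ℝ}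
    (hM : M.IsHermitian) {a b : X} (hab : a ≠ b) (h : Bool → ℝ) (hh : h false * h true = -1)
    (R : Bool → ℝ → Prop)
    (hR : ∀ (s : Bool) (ψ : X → ℝ) (μ : ℝ), M *ᵥ ψ = μ • ψ → h s * ψ a + ψ b ≠ 0 → R s μ)
    (hrel : ∀ {ι : Type} [Fintype ι] (x : ι → ℝ) (s : ι → Bool), (∀ i, R (s i) (x i)) →
      ∀ n : ι → ℤ, ∑ i, n i * x i = 0 → ∑ i, (if s i then n i else 0) = 0) :
    PrettyGoodFractionalRevival M {a, b} := by
  classical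
  set ψ : X → X → ℝ := fun z => hM.eigenvectorBasis z with hψ
  set ev := hM.eigenvalues with hev
  set y : Bool → X → ℝ := fun s z => h s * ψ z a + ψ z b with hy
  have hroot : ∀ s z, y s z ≠ 0 → R s (ev z) := fun s z hz =>
    hR s (ψ z) (ev z) (hM.mulVec_eigenvectorBasis z) hz
  -- An eigenvalue in both supports would satisfy the relation `μ - μ = 0`.
  have huniq : ∀ s s' z, y s z ≠ 0 → y s' z ≠ 0 → s = s' := by
    have key : ∀ z, y true z ≠ 0 → y false z ≠ 0 → False := by
      intro z h1 h2
      have := hrel (ι := Bool) (fun _ => ev z) id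
        (fun i => by cases i; exacts [hroot _ _ h2, hroot _ _ h1]) (fun i => if i then 1 else -1)
        (by simp)
      simp at this
    rintro (_ | _) (_ | _) z h1 h2
    exacts [rfl, (key z h2 h1).elim, (key z h1 h2).elim, rfl]
  -- Only eigenvectors which do not vanish on `{a, b}` matter; the phase of the others is free.
  choose σ hσ using fun i : {z // ∃ s, y s z ≠ 0} => i.2
  obtain ⟨t, ht0, ht⟩ := exists_tendsto_exp_of_relations
    (fun i : {z // ∃ s, y s z ≠ 0} => ev i) (fun i => if σ i then Real.pi else 0) (by
      intro n hn
      have := hrel (fun i : {z // ∃ s, y s z ≠ 0} => ev i) σ (fun i => hroot _ _ (hσ i)) n hn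
      have h2 : ∑ i, (n i : ℝ) * (if σ i then Real.pi else 0)
          = ((∑ i, (if σ i then n i else 0) : ℤ) : ℝ) * Real.pi := by
        push_cast
        rw [Finset.sum_mul]
        refine Finset.sum_congr rfl fun i _ => ?_
        split_ifs <;> simp
      rw [h2, this]
      simp)
  set sg : Bool → ℝ := fun s => if s then -1 else 1 with hsg
  have hexp : ∀ s z, Tendsto (fun n => Complex.exp (Complex.I * t n * ev z) * (y s z : ℂ)) atTop
      (𝓝 ((sg s : ℂ) * y s z)) := by
    intro s z
    by_cases hz : y s z = 0
    · simp [hz]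
    · refine Tendsto.mul_const _ ?_
      have := ht ⟨z, s, hz⟩
      rw [huniq _ _ _ (hσ ⟨z, s, hz⟩) hz] at this
      convert! this using 2
      cases s
      · simp [hsg]
      · simp [hsg, mul_comm Complex.I, Complex.exp_pi_mul_I]
  have hG : ∀ s x, Tendsto (fun n => h s * walk M (t n) x a + walk M (t n) x b) atTop
      (𝓝 ((sg s * (h s * (if x = a then 1 else 0) + (if x = b then 1 else 0)) : ℝ) : ℂ)) := by
    intro s x
    have h1 := tendsto_finsetSum Finset.univ fun z _ => (hexp s z).const_mul (ψ z x : ℂ)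
    have h2 : ∑ z, (ψ z x : ℂ) * ((sg s : ℂ) * y s z) =
        ((sg s * (h s * (if x = a then 1 else 0) + (if x = b then 1 else 0)) : ℝ) : ℂ) := by
      rw [← sum_eigenvectorBasis_mul hM x a, ← sum_eigenvectorBasis_mul hM x b]
      rw [Finset.mul_sum, ← Finset.sum_add_distrib, Finset.mul_sum, Complex.ofReal_sum]
      refine Finset.sum_congr rfl fun z _ => ?_
      simp only [hy, hψ]
      push_cast
      ring
    rw [h2] at h1
    refine h1.congr fun n => ?_
    rw [walk_apply hM, walk_apply hM, Finset.mul_sum, ← Finset.sum_add_distrib]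
    refine Finset.sum_congr rfl fun z _ => ?_
    simp only [hy, hψ]
    push_cast
    ring
  have hd : h false - h true ≠ 0 := by
    intro h0
    have : h false = h true := by linarith
    rw [this] at hh
    nlinarith [sq_nonneg (h true)]
  have hdc : (h false : ℂ) - h true ≠ 0 := by exact_mod_cast hd
  set d := h false - h true with hddef
  have hxa : ∀ x, Tendsto (fun n => walk M (t n) x a) atTop (𝓝 ((((h false + h true) *
      (if x = a then 1 else 0) + 2 * (if x = b then 1 else 0)) / d : ℝ) : ℂ)) := by
    intro x
    have h1 := ((hG false x).sub (hG true x)).div_const ((h false : ℂ) - h true)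
    convert! h1 using 2
    · rw [eq_div_iff hdc]; ring
    · rw [hddef]; push_cast [hsg]; congr 1; simp; ring
  have hxb : ∀ x, Tendsto (fun n => walk M (t n) x b) atTop (𝓝 (((2 * (if x = a then 1 else 0)
      - (h false + h true) * (if x = b then 1 else 0)) / d : ℝ) : ℂ)) := by
    intro x
    have h1 := (hG false x).sub ((hxa x).const_mul (h false : ℂ))
    convert! h1 using 2
    · ring
    · rw [← Complex.ofReal_mul, ← Complex.ofReal_sub]
      congr 1
      simp only [hsg, hddef] at hd ⊢
      field_simp
      simp only [Bool.false_eq_true, if_false]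
      linear_combination 2 * (if x = a then (1 : ℝ) else 0) * hh
  set m := h false + h true with hm
  have hnorm : m ^ 2 + 4 = d ^ 2 := by rw [hm, hddef]; linear_combination 4 * hh
  -- The limit of the blocks is the reflection with rows `(m, 2) / d` and `(2, -m) / d`.
  set T : Matrix ({a, b} : Finset X) ({a, b} : Finset X) ℂ := Matrix.of fun x y =>
    if y.1 = a then
      (((m * (if x.1 = a then 1 else 0) + 2 * (if x.1 = b then 1 else 0)) / d : ℝ) : ℂ)
    else (((2 * (if x.1 = a then 1 else 0) - m * (if x.1 = b then 1 else 0)) / d : ℝ) : ℂ) with hT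
  have hsum : ∀ f : ({a, b} : Finset X) → ℂ,
      ∑ x, f x = f ⟨a, by simp⟩ + f ⟨b, by simp⟩ := by
    intro f
    have h1 := Finset.sum_coe_sort ({a, b} : Finset X)
      (fun x => if hx : x ∈ ({a, b} : Finset X) then f ⟨x, hx⟩ else 0)
    rw [Finset.sum_pair hab] at h1
    simpa using h1
  have hdC : (d : ℂ) ≠ 0 := by exact_mod_cast hd
  have hnC : (m : ℂ) ^ 2 + 4 = (d : ℂ) ^ 2 := by exact_mod_cast hnorm
  intro hsub
  suffices hmem : T ∈ closure {A : Matrix ({a, b} : Finset X) ({a, b} : Finset X) ℂ |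
      ∃ t : ℝ, 0 ≤ t ∧ A = block {a, b} (walk M t)} ∧
      T ∈ Matrix.unitaryGroup ({a, b} : Finset X) ℂ by
    obtain ⟨ρ, hρ⟩ := hsub hmem
    have := congrFun (congrFun hρ ⟨a, by simp⟩) ⟨b, by simp⟩
    simp [hT, hab, hab.symm, hd] at this
  constructor
  · refine mem_closure_of_tendsto (f := fun n => block {a, b} (walk M (t n))) (b := atTop) ?_
      (Eventually.of_forall fun n => ⟨t n, ht0 n, rfl⟩)
    refine tendsto_pi_nhds.2 fun x => tendsto_pi_nhds.2 fun y => ?_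
    obtain ⟨y, hy⟩ := y
    simp only [block, submatrix_apply, hT, of_apply]
    rcases Finset.mem_insert.1 hy with rfl | hy
    · simpa using hxa x
    · obtain rfl := Finset.mem_singleton.1 hy
      simpa [hab.symm] using hxb x
  · rw [Matrix.mem_unitaryGroup_iff]
    ext ⟨x, hx⟩ ⟨z, hz⟩
    rw [Matrix.mul_apply, hsum]
    simp only [Finset.mem_insert, Finset.mem_singleton] at hx hz
    rcases hx with rfl | rfl <;> rcases hz with rfl | rfl <;>
      simp [hT, hab, hab.symm, Matrix.star_apply] <;> field_simp <;>
      first | linear_combination hnC | ring1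

end FractionalRevival

open Matrix Polynomial
namespace FractionalRevival

/-! ### Chains of vectors -/

/-- A solution `w` of the recurrence `μ w (j + 1) = w j + w (j + 2)` whose last two values are linked
by `g μ * w (k + 1) = f μ * w k` satisfies the same relation at every earlier place, with the
three-term polynomials in place of `f` and `g`. -/
theorem threeTerm_mul_eq {F : Type*} [Field F] [Algebra F ℝ] {f g : F[X]} {μ : ℝ} {w : ℕ → ℝ}
    {k : ℕ} (hw : ∀ j < k, μ * w (j + 1) = w j + w (j + 2))
    (hend : aeval μ g * w (k + 1) = aeval μ f * w k) :
    ∀ i ≤ k, aeval μ (threeTerm f g (i + 1)) * w (k - i + 1) =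
      aeval μ (threeTerm f g i) * w (k - i) := by
  intro i
  induction i with
  | zero => intro _; exact hend
  | succ i ih =>
    intro hi
    have h1 := ih (by omega)
    have h2 := hw (k - (i + 1)) (by omega)
    rw [show k - i = k - (i + 1) + 1 by omega] at h1
    simp only [threeTerm, map_sub, map_mul, aeval_X]
    linear_combination (aeval μ (threeTerm f g (i + 1))) * h2 + h1

/-- Pretty good fractional revival between the two ends of a matrix with potential `Q` on them, if
each of two orthogonal vectors `h s • e_a + e_b` generates a chain of vectors on which the matrix
acts by a tridiagonal matrix: `w` lists the inner products of an eigenvector with this chain,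
and the pair `f s`, `g s` describes the far end of the chain. -/
theorem prettyGood_of_chains {X : Type} [Fintype X] [DecidableEq X] {M : Matrix X X ℝ}
    (hM : M.IsHermitian) {a b : X} (hab : a ≠ b) (h : Bool → ℝ) (hh : h false * h true = -1)
    {F : Type*} [Field F] [CharZero F] [Algebra F ℝ] {Q : ℝ} (hQ : Transcendental F Q)
    (f g : Bool → F[X]) (e k : ℕ) (hf : ∀ s, (f s).Monic) (hfe : ∀ s, (f s).natDegree = e)
    (hg : ∀ s, (g s).Monic) (hge : ∀ s, (g s).natDegree = e + 1)
    (hgf : ∀ s, IsCoprime (g s) (f s)) (hne : (g false).coeff e ≠ (g true).coeff e)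
    (hchain : ∀ (s : Bool) (ψ : X → ℝ) (μ : ℝ), M *ᵥ ψ = μ • ψ →
      ∃ w : ℕ → ℝ, w 0 = Q * w 1 ∧ w 1 = h s * ψ a + ψ b ∧
        (∀ j < k, μ * w (j + 1) = w j + w (j + 2)) ∧
        aeval μ (g s) * w (k + 1) = aeval μ (f s) * w k) :
    PrettyGoodFractionalRevival M {a, b} := by
  refine prettyGood_of_sectors hM hab h hh (fun s μ =>
    aeval μ (threeTerm (f s) (g s) (k + 1)) - Q * aeval μ (threeTerm (f s) (g s) k) = 0) ?_ ?_
  · intro s ψ μ hψ hne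
    obtain ⟨w, h0, h1, hw, hend⟩ := hchain s ψ μ hψ
    have h2 := threeTerm_mul_eq hw hend k le_rfl
    rw [Nat.sub_self, zero_add, h0] at h2
    rw [← h1] at hne
    exact (mul_eq_zero.1 (by linear_combination h2)).resolve_right hne
  · intro ι _ x s hx n hn
    have key := fun s n => threeTerm_natDegree_coeff (hf s) (hfe s) (hg s) (hge s) rfl n
    obtain ⟨e1, e2⟩ := pencil_relations hQ (fun s => threeTerm (f s) (g s) (k + 1))
      (fun s => threeTerm (f s) (g s) k) (e + k) (fun s => (g s).coeff e)
      (fun s => (key s (k + 1)).1) (fun s => (key s (k + 1)).2.1) (fun s => (key s k).1)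
      (fun s => (key s k).2.1) (fun s => isCoprime_threeTerm (hgf s) k) (fun s => (key s k).2.2)
      x s hx n hn
    have e3 : ∑ i, (n i : F) * (g (s i)).coeff e = (∑ i, n i : ℤ) * (g false).coeff e +
        (∑ i, (if s i then n i else 0) : ℤ) * ((g true).coeff e - (g false).coeff e) := by
      push_cast
      rw [Finset.sum_mul, Finset.sum_mul, ← Finset.sum_add_distrib]
      refine Finset.sum_congr rfl fun i _ => ?_
      cases s i
      · simp
      · simp; ring
    rw [e3, e1, Int.cast_zero, zero_mul, zero_add] at e2
    exact_mod_cast (mul_eq_zero.1 e2).resolve_right (sub_ne_zero.2 hne.symm)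

/-! ### The two orthogonal vectors on the ends -/

/-- The two roots of `h ^ 2 = m * h + 1`, whose product is `-1`. -/
noncomputable def sectorRoot (m : ℝ) (s : Bool) : ℝ :=
  (m + (if s then -1 else 1) * √(m ^ 2 + 4)) / 2

theorem sectorRoot_sq (m : ℝ) (s : Bool) :
    sectorRoot m s ^ 2 = m * sectorRoot m s + 1 := by
  have := Real.sq_sqrt (show 0 ≤ m ^ 2 + 4 by positivity)
  cases s <;> simp only [sectorRoot] <;> simp <;> linear_combination this / 4

theorem sectorRoot_mul (m : ℝ) : sectorRoot m false * sectorRoot m true = -1 := by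
  have := Real.sq_sqrt (show 0 ≤ m ^ 2 + 4 by positivity)
  simp only [sectorRoot]
  simp
  linear_combination -this / 4

theorem sectorRoot_ne (m : ℝ) : sectorRoot m false ≠ sectorRoot m true := by
  have : 0 < √(m ^ 2 + 4) := Real.sqrt_pos.2 (by positivity)
  simp only [sectorRoot]
  simp
  linarith

theorem sectorRoot_mem {m : ℝ} (hm : IsAlgebraic ℚ m) (s : Bool) :
    sectorRoot m s ∈ algebraicClosure ℚ ℝ := by
  have hm' : m ∈ algebraicClosure ℚ ℝ := mem_algebraicClosure_iff.2 hm
  have hr : √(m ^ 2 + 4) ∈ algebraicClosure ℚ ℝ := by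
    refine mem_algebraicClosure_iff.2 (IsAlgebraic.of_pow two_pos ?_)
    rw [Real.sq_sqrt (by positivity)]
    exact mem_algebraicClosure_iff.1 (add_mem (pow_mem hm' 2) (ofNat_mem _ 4))
  refine div_mem (add_mem hm' (mul_mem ?_ hr)) (ofNat_mem _ 2)
  split_ifs
  exacts [neg_mem (one_mem _), one_mem _]

/-! ### Eigenvalue equations along a path -/

/-- The extension by zero of a function on `Fin n`. -/
def extendZero {n : ℕ} (ψ : Fin n → ℝ) (j : ℕ) : ℝ := if h : j < n then ψ ⟨j, h⟩ else 0

theorem extendZero_val {n : ℕ} (ψ : Fin n → ℝ) (j : Fin n) : extendZero ψ j = ψ j := by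
  simp [extendZero]

theorem sum_ite_val_eq {n : ℕ} (ψ : Fin n → ℝ) (c : ℕ) :
    ∑ j : Fin n, (if j.val = c then ψ j else 0) = extendZero ψ c := by
  by_cases hc : c < n
  · rw [Finset.sum_eq_single (⟨c, hc⟩ : Fin n)]
    · simp [extendZero, hc]
    · intro j _ hj
      rw [if_neg fun h => hj (Fin.ext h)]
    · simp
  · rw [extendZero, dif_neg hc]
    exact Finset.sum_eq_zero fun j _ => if_neg (by omega)

theorem sum_path {n : ℕ} (ψ : Fin n → ℝ) (i : ℕ) :
    ∑ j : Fin n, (if i + 1 = j.val ∨ j.val + 1 = i then ψ j else 0) =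
      extendZero ψ (i + 1) + (if i = 0 then 0 else extendZero ψ (i - 1)) := by
  rw [← sum_ite_val_eq ψ (i + 1)]
  rcases i with _ | i
  · simp [eq_comm]
  · rw [if_neg (Nat.succ_ne_zero i), Nat.add_sub_cancel, ← sum_ite_val_eq ψ i,
      ← Finset.sum_add_distrib]
    refine Finset.sum_congr rfl fun j _ => ?_
    split_ifs <;> first | omega | simp

theorem diagInd_mulVec {X : Type*} [Fintype X] [DecidableEq X] (K : Finset X) (ψ : X → ℝ) (x : X) :
    (diagInd K *ᵥ ψ) x = if x ∈ K then ψ x else 0 := by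
  rw [diagInd, mulVec_diagonal]
  split_ifs <;> simp

theorem isHermitian_add_diagInd {X : Type*} [Fintype X] [DecidableEq X] {M : Matrix X X ℝ}
    (hM : M.IsHermitian) (Q : ℝ) (K : Finset X) : (M + Q • diagInd K).IsHermitian := by
  refine hM.add ?_
  rw [IsHermitian, conjTranspose_smul, diagInd, diagonal_conjTranspose]
  simp

/-! ### The graphs S -/

/-- The eigenvalue equation at the vertices of `S_{k,m}`. -/
theorem matS_eigenvector {k : ℕ} {m Q μ : ℝ} {ψ : Fin (2 * k + 2) → ℝ}
    (hψ : (matS k m + Q • diagInd (endsS k)) *ᵥ ψ = μ • ψ) (i : ℕ) (hi : i < 2 * k + 2) :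
    μ * extendZero ψ i = extendZero ψ (i + 1) + (if i = 0 then 0 else extendZero ψ (i - 1)) +
      (if i = k then m * extendZero ψ k else 0) +
      (if i = 0 ∨ i = 2 * k + 1 then Q * extendZero ψ i else 0) := by
  have h := congrFun hψ ⟨i, hi⟩
  rw [add_mulVec, smul_mulVec, Pi.add_apply, Pi.smul_apply, Pi.smul_apply, diagInd_mulVec] at h
  have h1 : extendZero ψ i = ψ ⟨i, hi⟩ := extendZero_val ψ ⟨i, hi⟩
  have h2 : (matS k m *ᵥ ψ) ⟨i, hi⟩ = extendZero ψ (i + 1) +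
      (if i = 0 then 0 else extendZero ψ (i - 1)) + (if i = k then m * extendZero ψ k else 0) := by
    rw [← sum_path, ← sum_ite_val_eq ψ k, Finset.mul_sum]
    have : (if i = k then ∑ j : Fin (2 * k + 2), m * (if j.val = k then ψ j else 0) else 0) =
        ∑ j : Fin (2 * k + 2), (if i = k then m * (if j.val = k then ψ j else 0) else 0) := by
      split_ifs <;> simp
    rw [this, ← Finset.sum_add_distrib, mulVec, dotProduct]
    refine Finset.sum_congr rfl fun j _ => ?_
    simp only [matS, of_apply]
    split_ifs <;> first | omega | simp
  rw [h2] at h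
  rw [h1]
  simp only [smul_eq_mul] at h
  rw [← h]
  congr 1
  have : (⟨i, hi⟩ : Fin (2 * k + 2)) ∈ endsS k ↔ i = 0 ∨ i = 2 * k + 1 := by
    simp [endsS, Fin.ext_iff]
  simp only [this]
  split_ifs <;> simp

theorem matS_isHermitian (k : ℕ) (m : ℝ) : (matS k m).IsHermitian := by
  ext i j
  simp only [conjTranspose_apply, matS, of_apply, star_trivial]
  split_ifs <;> first | rfl | omega

/-- Pairing an eigenvector of `S_{k,m}` with the vectors `h e_j + e_{2k+1-j}`, `j = 0, …, k`, gives a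
solution of the three-term recurrence. The equation `h ^ 2 = m h + 1` makes the chain close up at
the middle edge. The value `w 0 = Q w 1` encodes the potential at the ends. -/
theorem matS_chain {k : ℕ} {m Q μ h : ℝ} {ψ : Fin (2 * k + 2) → ℝ} (hh : h ^ 2 = m * h + 1)
    (hψ : (matS k m + Q • diagInd (endsS k)) *ᵥ ψ = μ • ψ) :
    ∃ w : ℕ → ℝ, w 0 = Q * w 1 ∧ w 1 = h * ψ 0 + ψ (Fin.last (2 * k + 1)) ∧
      (∀ j < k, μ * w (j + 1) = w j + w (j + 2)) ∧ (μ - h) * w (k + 1) = w k := by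
  have E := matS_eigenvector hψ
  set φ := extendZero ψ with hφ
  have hlast : φ (2 * k + 1 + 1) = 0 := by simp [hφ, extendZero]
  have hφ0 : φ 0 = ψ 0 := extendZero_val ψ 0
  have hφl : φ (2 * k + 1) = ψ (Fin.last (2 * k + 1)) := extendZero_val ψ (Fin.last (2 * k + 1))
  set y : ℕ → ℝ := fun j => h * φ j + φ (2 * k + 1 - j) with hy
  refine ⟨fun j => if j = 0 then Q * y 0 else y (j - 1), by simp, by simp [hy, hφ0, hφl], ?_, ?_⟩
  · intro j hj
    simp only [Nat.add_eq_zero_iff, one_ne_zero, OfNat.ofNat_ne_zero, and_false, if_false,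
      Nat.add_sub_cancel]
    rw [show j + 2 - 1 = j + 1 by omega]
    have e1 := E j (by omega)
    have e2 := E (2 * k + 1 - j) (by omega)
    rcases Nat.eq_zero_or_pos j with rfl | hj0
    · rw [Nat.sub_zero, hlast] at e2
      rw [if_pos rfl, if_neg (by omega), if_pos (by omega)] at e1
      rw [if_neg (by omega), if_neg (by omega), if_pos (by omega)] at e2
      simp only [hy, Nat.sub_zero, if_true]
      rw [show 2 * k + 1 - (0 + 1) = 2 * k + 1 - 1 by omega]
      linear_combination h * e1 + e2
    · rw [if_neg (by omega), if_neg (by omega), if_neg (by omega)] at e1 e2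
      rw [if_neg (by omega)]
      simp only [hy]
      rw [show 2 * k + 1 - (j + 1) = 2 * k + 1 - j - 1 by omega,
        show 2 * k + 1 - (j - 1) = 2 * k + 1 - j + 1 by omega]
      linear_combination h * e1 + e2
  · simp only [Nat.add_eq_zero_iff, one_ne_zero, and_false, if_false, Nat.add_sub_cancel]
    have e1 := E k (by omega)
    have e2 := E (k + 1) (by omega)
    rw [if_pos rfl] at e1
    rw [if_neg (by omega), if_neg (by omega), Nat.add_sub_cancel] at e2
    rcases Nat.eq_zero_or_pos k with rfl | hk
    · have hl : φ 2 = 0 := hlast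
      simp only [hy, Nat.mul_zero, zero_add, Nat.sub_zero, if_true, true_or, or_true,
        Nat.reduceAdd, hl] at e1 e2 ⊢
      linear_combination h * e1 + e2 - φ 0 * hh
    · rw [if_neg (by omega), if_neg (by omega)] at e1
      rw [if_neg (by omega)] at e2
      rw [if_neg (by omega)]
      simp only [hy]
      rw [show 2 * k + 1 - k = k + 1 by omega, show 2 * k + 1 - (k - 1) = k + 1 + 1 by omega]
      linear_combination h * e1 + e2 - φ k * hh

/-- Every `S_{k,m}` has the chains with `f = 1` and `g = X - h`. -/
theorem matS_prettyGood {Q : ℝ} (hQ : Transcendental ℚ Q) (k : ℕ) {m : ℝ} (hm : IsAlgebraic ℚ m) :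
    PrettyGoodFractionalRevival (matS k m + Q • diagInd (endsS k)) (endsS k) := by
  refine prettyGood_of_chains (isHermitian_add_diagInd (matS_isHermitian k m) Q _)
    (a := 0) (b := Fin.last (2 * k + 1)) (Fin.last_pos.ne) (sectorRoot m) (sectorRoot_mul m)
    hQ.algebraicClosure (fun _ => 1)
    (fun s => X - C ⟨sectorRoot m s, sectorRoot_mem hm s⟩) 0 k (fun _ => monic_one)
    (fun _ => natDegree_one) (fun _ => monic_X_sub_C _) (fun _ => natDegree_X_sub_C _)
    (fun _ => isCoprime_one_right) ?_ ?_
  · simpa [Subtype.ext_iff] using sectorRoot_ne m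
  · intro s ψ μ hψ
    obtain ⟨w, h0, h1, hw, he⟩ := matS_chain (sectorRoot_sq m s) hψ
    refine ⟨w, h0, h1, hw, ?_⟩
    rw [map_one, one_mul, ← he]
    simp [IntermediateField.algebraMap_apply]

/-! ### The graphs T -/

/-- An entry of the adjacency matrix of `T_k` times a number, for any description `p` of adjacency. -/
theorem matT_mul {k : ℕ} {v w : Fin (2 * k + 2) ⊕ Extra} {p : Prop} [Decidable p]
    (h : adjT k v w ↔ p) (r : ℝ) : matT k v w * r = if p then r else 0 := by
  have h' : (graphT k).Adj v w ↔ p := h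
  rw [matT, SimpleGraph.adjMatrix_apply]
  by_cases hp : p
  · rw [if_pos (h'.2 hp), if_pos hp, one_mul]
  · rw [if_neg (mt h'.1 hp), if_neg hp, zero_mul]

/-- The eigenvalue equation at the vertices of the path of `T_k`. -/
theorem matT_eigenvector_inl {k : ℕ} {Q μ : ℝ} {ψ : Fin (2 * k + 2) ⊕ Extra → ℝ}
    (hψ : (matT k + Q • diagInd (endsT k)) *ᵥ ψ = μ • ψ) (i : ℕ) (hi : i < 2 * k + 2) :
    μ * extendZero (ψ ∘ Sum.inl) i = extendZero (ψ ∘ Sum.inl) (i + 1) +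
      (if i = 0 then 0 else extendZero (ψ ∘ Sum.inl) (i - 1)) +
      (if i + 1 = k ∨ i = k then ψ (.inr .x) else 0) + (if i = k + 2 then ψ (.inr .b) else 0) +
      (if i = 0 ∨ i = 2 * k + 1 then Q * extendZero (ψ ∘ Sum.inl) i else 0) := by
  have h := congrFun hψ (.inl ⟨i, hi⟩)
  rw [add_mulVec, smul_mulVec, Pi.add_apply, Pi.smul_apply, Pi.smul_apply, diagInd_mulVec] at h
  have h1 : extendZero (ψ ∘ Sum.inl) i = ψ (.inl ⟨i, hi⟩) := extendZero_val (ψ ∘ Sum.inl) ⟨i, hi⟩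
  have h2 : (matT k *ᵥ ψ) (.inl ⟨i, hi⟩) = extendZero (ψ ∘ Sum.inl) (i + 1) +
      (if i = 0 then 0 else extendZero (ψ ∘ Sum.inl) (i - 1)) +
      (if i + 1 = k ∨ i = k then ψ (.inr .x) else 0) +
      (if i = k + 2 then ψ (.inr .b) else 0) := by
    rw [← sum_path, mulVec, dotProduct, Fintype.sum_sum_type, add_assoc]
    congr 1
    · exact Finset.sum_congr rfl fun j _ => matT_mul (by exact Iff.rfl) _
    · rw [show (Finset.univ : Finset Extra) = {Extra.x, Extra.b} from rfl,
        Finset.sum_pair (by decide)]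
      exact congrArg₂ (· + ·) (matT_mul (by exact Iff.rfl) _) (matT_mul (by exact Iff.rfl) _)
  rw [h2] at h
  rw [h1]
  simp only [smul_eq_mul] at h
  rw [← h]
  congr 1
  have : (Sum.inl ⟨i, hi⟩ : Fin (2 * k + 2) ⊕ Extra) ∈ endsT k ↔ i = 0 ∨ i = 2 * k + 1 := by
    simp [endsT, Fin.ext_iff]
  simp only [this]
  split_ifs <;> simp

/-- The eigenvalue equations at the two new vertices of `T_k`. -/
theorem matT_eigenvector_inr {k : ℕ} (hk : 1 ≤ k) {Q μ : ℝ} {ψ : Fin (2 * k + 2) ⊕ Extra → ℝ}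
    (hψ : (matT k + Q • diagInd (endsT k)) *ᵥ ψ = μ • ψ) :
    μ * ψ (.inr .x) = extendZero (ψ ∘ Sum.inl) (k - 1) + extendZero (ψ ∘ Sum.inl) k ∧
      μ * ψ (.inr .b) = extendZero (ψ ∘ Sum.inl) (k + 2) := by
  have h : ∀ v : Extra, (matT k *ᵥ ψ) (.inr v) = μ * ψ (.inr v) := by
    intro v
    have h := congrFun hψ (.inr v)
    rw [add_mulVec, smul_mulVec, Pi.add_apply, Pi.smul_apply, Pi.smul_apply, diagInd_mulVec,
      if_neg (by simp [endsT])] at h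
    simpa using h
  rw [← h, ← h]
  simp only [mulVec, dotProduct, Fintype.sum_sum_type]
  rw [← sum_ite_val_eq, ← sum_ite_val_eq, ← sum_ite_val_eq, ← Finset.sum_add_distrib]
  have h0 : ∀ v : Extra, ∑ u : Extra, matT k (.inr v) (.inr u) * ψ (.inr u) = 0 := fun v =>
    Finset.sum_eq_zero fun u _ => (matT_mul (p := False) (by cases v <;> cases u <;> exact Iff.rfl) _).trans (if_neg not_false)
  rw [h0, h0, add_zero, add_zero]
  constructor
  · refine Finset.sum_congr rfl fun j _ => ?_
    rw [matT_mul (p := j.val + 1 = k ∨ j.val = k) Iff.rfl]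
    simp only [Function.comp]
    split_ifs <;> first | omega | simp
  · exact Finset.sum_congr rfl fun j _ => matT_mul (by exact Iff.rfl) _

theorem matT_isHermitian (k : ℕ) : (matT k).IsHermitian := by
  classical
  rw [IsHermitian, conjTranspose_eq_transpose_of_trivial]
  exact (graphT k).transpose_adjMatrix

/-- Pairing an eigenvector of `T_{k+1}` with the vectors `h e_j + e_{2k+3-j}`, `j = 0, …, k`, gives a
solution of the three-term recurrence. The chain is continued by two vectors in the middle of the
graph, `h (e_{k+1} + e_x) + e_{k+2} + e_b` and `e_{k+1} - e_x + h (e_{k+2} - e_b)`, and closes up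
there as `h ^ 2 = 2 h + 1`. The last equation is what remains after their elimination. -/
theorem matT_chain {k : ℕ} {Q μ h : ℝ} {ψ : Fin (2 * (k + 1) + 2) ⊕ Extra → ℝ}
    (hh : h ^ 2 = 2 * h + 1)
    (hψ : (matT (k + 1) + Q • diagInd (endsT (k + 1))) *ᵥ ψ = μ • ψ) :
    ∃ w : ℕ → ℝ, w 0 = Q * w 1 ∧
      w 1 = h * ψ (.inl 0) + ψ (.inl (Fin.last (2 * (k + 1) + 1))) ∧
      (∀ j < k, μ * w (j + 1) = w j + w (j + 2)) ∧
      (μ ^ 3 - (h - 1) * μ ^ 2 - 2 * μ + (h - 2)) * w (k + 1) = (μ ^ 2 - (h - 1) * μ) * w k := by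
  have E := matT_eigenvector_inl hψ
  obtain ⟨Ex, Eb⟩ := matT_eigenvector_inr (Nat.le_add_left 1 k) hψ
  set φ := extendZero (ψ ∘ Sum.inl) with hφ
  set u := ψ (.inr .x)
  set v := ψ (.inr .b)
  have hlast : φ (2 * (k + 1) + 1 + 1) = 0 := by simp [hφ, extendZero]
  have hφ0 : φ 0 = ψ (.inl 0) := extendZero_val (ψ ∘ Sum.inl) 0
  have hφl : φ (2 * (k + 1) + 1) = ψ (.inl (Fin.last (2 * (k + 1) + 1))) :=
    extendZero_val (ψ ∘ Sum.inl) (Fin.last (2 * (k + 1) + 1))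
  rw [Nat.add_sub_cancel] at Ex
  set y : ℕ → ℝ := fun j => h * φ j + φ (2 * (k + 1) + 1 - j) with hy
  refine ⟨fun j => if j = 0 then Q * y 0 else y (j - 1), by simp, by simp [hy, hφ0, hφl], ?_, ?_⟩
  · intro j hj
    simp only [Nat.add_eq_zero_iff, one_ne_zero, OfNat.ofNat_ne_zero, and_false, if_false,
      Nat.add_sub_cancel]
    rw [show j + 2 - 1 = j + 1 by omega]
    have e1 := E j (by omega)
    have e2 := E (2 * (k + 1) + 1 - j) (by omega)
    rcases Nat.eq_zero_or_pos j with rfl | hj0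
    · rw [Nat.sub_zero, hlast] at e2
      rw [if_pos rfl, if_neg (by omega), if_neg (by omega), if_pos (by omega)] at e1
      rw [if_neg (by omega), if_neg (by omega), if_neg (by omega), if_pos (by omega)] at e2
      simp only [hy, Nat.sub_zero, if_true]
      rw [show 2 * (k + 1) + 1 - (0 + 1) = 2 * (k + 1) + 1 - 1 by omega]
      linear_combination h * e1 + e2
    · rw [if_neg (by omega), if_neg (by omega), if_neg (by omega), if_neg (by omega)] at e1 e2
      rw [if_neg (by omega)]
      simp only [hy]
      rw [show 2 * (k + 1) + 1 - (j + 1) = 2 * (k + 1) + 1 - j - 1 by omega,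
        show 2 * (k + 1) + 1 - (j - 1) = 2 * (k + 1) + 1 - j + 1 by omega]
      linear_combination h * e1 + e2
  · set Y := h * (φ (k + 1) + u) + φ (k + 2) + v with hY
    set z := φ (k + 1) - u + h * (φ (k + 2) - v) with hz
    have e1 := E (k + 1) (by omega)
    have e2 := E (k + 2) (by omega)
    rw [if_neg (by omega), if_pos (by omega), if_neg (by omega), if_neg (by omega),
      Nat.add_sub_cancel] at e1
    rw [if_neg (by omega), if_neg (by omega), if_neg (by omega), if_neg (by omega),
      show k + 2 - 1 = k + 1 by omega] at e2
    have rY : μ * Y = 2 * y k + h / 2 * Y + z / 2 := by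
      simp only [hY, hz, hy]
      rw [show 2 * (k + 1) + 1 - k = k + 1 + 2 by omega]
      linear_combination h * e1 + h * Ex + e2 + Eb - (φ (k + 1) + u) / 2 * hh
    have rz : μ * z = (h / 2 - 1) * z + Y / 2 := by
      simp only [hY, hz]
      linear_combination e1 - Ex + h * e2 - h * Eb - (φ (k + 2) - v) / 2 * hh
    have ry : μ * y k = (if k = 0 then Q * y 0 else y (k - 1)) + Y := by
      have e3 := E k (by omega)
      have e4 := E (k + 3) (by omega)
      rw [if_neg (by omega), if_neg (by omega), if_pos (by omega),
        show k + 3 - 1 = k + 2 by omega] at e4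
      rcases Nat.eq_zero_or_pos k with rfl | hk
      · rw [if_pos rfl, if_pos (by omega), if_neg (by omega), if_pos (by omega)] at e3
        have hl : φ 4 = 0 := hlast
        simp only [hy, hY, Nat.mul_one, zero_add, Nat.sub_zero, if_true, or_true,
          Nat.reduceAdd, hl] at e3 e4 ⊢
        linear_combination h * e3 + e4
      · rw [if_neg (by omega), if_pos (by omega), if_neg (by omega), if_neg (by omega)] at e3
        rw [if_neg (by omega)] at e4
        rw [if_neg (by omega)]
        simp only [hy, hY]
        rw [show 2 * (k + 1) + 1 - k = k + 3 by omega,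
          show 2 * (k + 1) + 1 - (k - 1) = k + 3 + 1 by omega]
        linear_combination h * e3 + e4
    simp only [Nat.add_eq_zero_iff, one_ne_zero, and_false, if_false, Nat.add_sub_cancel]
    linear_combination (μ ^ 2 - (h - 1) * μ) * ry + (μ - (h / 2 - 1)) * rY + rz / 2 - Y / 4 * hh

/-- Every `T_k` with `k ≥ 1` has chains; their far ends have `f = X ^ 2 - (h - 1) X` and
`g = X ^ 3 - (h - 1) X ^ 2 - 2 X + (h - 2)`. -/
theorem matT_prettyGood {Q : ℝ} (hQ : Transcendental ℚ Q) {k : ℕ} (hk : 1 ≤ k) :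
    PrettyGoodFractionalRevival (matT k + Q • diagInd (endsT k)) (endsT k) := by
  obtain ⟨k, rfl⟩ := Nat.exists_eq_add_of_le' hk
  have hm : IsAlgebraic ℚ (2 : ℝ) := by exact_mod_cast isAlgebraic_natCast (R := ℚ) (A := ℝ) 2
  set η : Bool → algebraicClosure ℚ ℝ := fun s => ⟨sectorRoot 2 s, sectorRoot_mem hm s⟩ with hη
  have hη2 : ∀ s, η s ^ 2 = 2 * η s + 1 := fun s => Subtype.ext (sectorRoot_sq 2 s)
  have hC2 : ∀ s, (C (η s) : (algebraicClosure ℚ ℝ)[X]) ^ 2 = 2 * C (η s) + 1 := by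
    intro s
    rw [← C_pow, hη2, C_add, C_mul, C_1, C_ofNat]
  refine prettyGood_of_chains (isHermitian_add_diagInd (matT_isHermitian (k + 1)) Q _)
    (a := .inl 0) (b := .inl (Fin.last (2 * (k + 1) + 1)))
    (Sum.inl_injective.ne Fin.last_pos.ne) (sectorRoot 2) (sectorRoot_mul 2)
    hQ.algebraicClosure (fun s => X ^ 2 - C (η s - 1) * X)
    (fun s => X ^ 3 - C (η s - 1) * X ^ 2 - C 2 * X + C (η s - 2)) 2 k ?_ ?_ ?_ ?_ ?_ ?_ ?_
  · intro s; monicity!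
  · intro s; compute_degree!
  · intro s; monicity!
  · intro s; compute_degree!
  · intro s
    -- The Bézout coefficients come from the Euclidean algorithm, with `h ^ 2 = 2 h + 1`.
    refine ⟨-(2 * X - C (η s)), -4 + X * (2 * X - C (η s)), ?_⟩
    simp only [C_sub, C_1, C_ofNat]
    linear_combination hC2 s
  · simp only [coeff_add, coeff_sub, coeff_C_mul, coeff_X_pow, coeff_C, coeff_X]
    simpa [hη, Subtype.ext_iff] using sectorRoot_ne 2
  · intro s ψ μ hψ
    obtain ⟨w, h0, h1, hw, he⟩ := matT_chain (sectorRoot_sq 2 s) hψ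
    refine ⟨w, h0, h1, hw, ?_⟩
    have hη' : algebraMap (algebraicClosure ℚ ℝ) ℝ (η s) = sectorRoot 2 s := rfl
    simp only [map_add, map_sub, map_mul, map_pow, aeval_X, aeval_C, hη', map_one, map_ofNat]
    exact he

end FractionalRevival
theorem mainTheorem6 (Q : ℝ) (hQ : Transcendental ℚ Q) :
    (∀ (k : ℕ) (m : ℝ), IsAlgebraic ℚ m →
      FractionalRevival.PrettyGoodFractionalRevival
        (FractionalRevival.matS k m + Q • FractionalRevival.diagInd (FractionalRevival.endsS k))
        (FractionalRevival.endsS k)) ∧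
    (∀ k : ℕ, 1 ≤ k →
      FractionalRevival.PrettyGoodFractionalRevival
        (FractionalRevival.matT k + Q • FractionalRevival.diagInd (FractionalRevival.endsT k))
        (FractionalRevival.endsT k)) :=
  ⟨fun k _ hm => FractionalRevival.matS_prettyGood hQ k hm,
    fun _ hk => FractionalRevival.matT_prettyGood hQ hk⟩
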